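/- Let $H$ be a complex Hilbert space, $\mathcal B(H)$ the bounded operators on $H$ with the weak$^*$-topology given by the predual $\mathcal B(H)_*$, and $HS(H)\subseteq\mathcal B(H)$ the Hilbert--Schmidt operators with the Hilbert--Schmidt norm. Let $M\subseteq\mathcal B(H)$ be a von Neumann algebra with commutant $M'$. A \emph{quantum relation} over $M$ is a weak$^*$-closed linear subspace $\mathcal S\subseteq\mathcal B(H)$ with $a x b\in\mathcal S$ for all $x\in\mathcal S$ and $a,b\in M'$. An \emph{HS quantum relation} over $M$ is a linear subspace $V\subseteq HS(H)$ that is closed for the Hilbert--Schmidt norm and satisfies $axb\in V$ for all $x\in V$ and $a,b\in M'$. For a weak$^*$-closed subspace $\mathcal S\subseteq\mathcal B(H)$ let $\mathcal S_{HS}$ be the closure of $\mathcal S\cap HS(H)$ in the Hilbert--Schmidt norm; for a subspace $V\subseteq HS(H)$ let $V_{w^*}$ be the weak$^*$-closure of $V$ in $\mathcal B(H)$. Put $\mathcal S^{hsh}=(\mathcal S_{HS})_{w^*}$ and $V^{hsc}=(V_{w^*})_{HS}$. Then $\mathcal S_{HS}=\mathcal S\cap HS(H)$ for every quantum relation $\mathcal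 S$ over $M$; moreover \[ \{\mathcal S_{HS} : \mathcal S \text{ a quantum relation over } M\} = \{V : V \text{ an HS quantum relation over } M,\ V=V^{hsc}\}, \] \[ \{V_{w^*} : V \text{ an HS quantum relation over } M\} = \{\mathcal S : \mathcal S \text{ a quantum relation over } M,\ \mathcal S=\mathcal S^{hsh}\}, \] and the maps $\mathcal S\mapsto\mathcal S_{HS}$ and $V\mapsto V_{w^*}$ restrict to mutually inverse bijections between these two sets. -/

import Mathlib

open scoped InnerProductSpace ENNReal

noncomputable section

namespace HSQuantum

variable (H : Type*) [NormedAddCommGroup H] [InnerProductSpace ℂ H] [CompleteSpace H]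

/-! ### Hilbert–Schmidt operators -/

/-- The index set of a fixed orthonormal (Hilbert) basis of `H`. -/
def basisIndex : Set H := (exists_hilbertBasis ℂ H).choose

/-- A fixed orthonormal (Hilbert) basis of `H`. -/
def basis : HilbertBasis (basisIndex H) ℂ H := (exists_hilbertBasis ℂ H).choose_spec.choose

/-- The subspace of `B(H)` of the operators `x` with `∑ i, ‖x (e i)‖ ^ 2 < ∞`, for the fixed
orthonormal basis `e`; by `tsum_enorm_sq_eq` below the sum does not depend on the basis. -/
def hsSubmodule : Submodule ℂ (H →L[ℂ] H) where
  carrier := {x | Memℓp (fun i => x (basis H i)) 2}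
  zero_mem' := zero_memℓp
  add_mem' hx hy := hx.add hy
  smul_mem' c _ hx := hx.const_smul c

/-- The space `HS(H)` of Hilbert–Schmidt operators. It is a type of its own, because its norm is
the Hilbert–Schmidt norm and not the operator norm. -/
def HilbertSchmidt : Type _ := hsSubmodule H

instance : AddCommGroup (HilbertSchmidt H) := inferInstanceAs (AddCommGroup (hsSubmodule H))

instance : Module ℂ (HilbertSchmidt H) := inferInstanceAs (Module ℂ (hsSubmodule H))

/-- The inclusion `HS(H) ⊆ B(H)`. -/
def toOp : HilbertSchmidt H →ₗ[ℂ] (H →L[ℂ] H) := (hsSubmodule H).subtype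

/-- A Hilbert–Schmidt operator `x` as the square-summable family `i ↦ x (e i)`. -/
def toL2 : HilbertSchmidt H →ₗ[ℂ] lp (fun _ : basisIndex H => H) 2 where
  toFun x := ⟨fun i => toOp H x (basis H i), x.2⟩
  map_add' _ _ := rfl
  map_smul' _ _ := rfl

theorem toL2_injective : Function.Injective (toL2 H) := by
  intro x y h
  have h1 : ∀ i, toOp H x (basis H i) = toOp H y (basis H i) := fun i =>
    congrArg (fun f : lp (fun _ : basisIndex H => H) 2 => f i) h
  apply Subtype.ext
  refine ContinuousLinearMap.ext_on (s := Set.range (basis H)) ?_ ?_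
  · have := (basis H).dense_span
    rw [Submodule.dense_iff_topologicalClosure_eq_top]
    exact this
  · rintro _ ⟨i, rfl⟩
    exact h1 i

/-- The Hilbert–Schmidt norm `(∑ i, ‖x (e i)‖ ^ 2) ^ (1 / 2)` on `HS(H)`. -/
instance : NormedAddCommGroup (HilbertSchmidt H) :=
  NormedAddCommGroup.induced _ _ (toL2 H) (toL2_injective H)

instance : NormedSpace ℂ (HilbertSchmidt H) := NormedSpace.induced ℂ _ _ (toL2 H)

variable {H}

theorem norm_sq_eq (x : HilbertSchmidt H) :
    ‖x‖ ^ 2 = ∑' i, ‖toOp H x (basis H i)‖ ^ 2 := by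
  have h := lp.norm_rpow_eq_tsum (p := 2) (by norm_num) (toL2 H x)
  have h2 : ‖x‖ = ‖toL2 H x‖ := rfl
  rw [h2]
  simp only [ENNReal.toReal_ofNat, Real.rpow_ofNat] at h
  exact h

theorem tsum_enorm_inner_sq {ι : Type*} (b : HilbertBasis ι ℂ H) (v : H) :
    ∑' i, ‖⟪b i, v⟫_ℂ‖ₑ ^ 2 = ‖v‖ₑ ^ 2 := by
  have h := lp.norm_rpow_eq_tsum (p := 2) (by norm_num) (b.repr v)
  have hs := (lp.memℓp (b.repr v)).summable (by norm_num)
  simp only [ENNReal.toReal_ofNat, Real.rpow_ofNat, LinearIsometryEquiv.norm_map,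
    HilbertBasis.repr_apply_apply] at h hs
  have e : ∀ {E : Type _} [NormedAddCommGroup E] (w : E), ‖w‖ₑ ^ 2 = ENNReal.ofReal (‖w‖ ^ 2) := by
    intro E _ w
    rw [ENNReal.ofReal_pow (norm_nonneg _), ofReal_norm]
  have e' : ∀ w : ℂ, ‖w‖ₑ ^ 2 = ENNReal.ofReal (‖w‖ ^ 2) := by
    intro w
    rw [ENNReal.ofReal_pow (norm_nonneg _), ofReal_norm]
  rw [e, h, ENNReal.ofReal_tsum_of_nonneg (fun _ => by positivity) hs]
  simp only [e']

theorem tsum_enorm_sq_eq_adjoint {ι κ : Type*} (b : HilbertBasis ι ℂ H)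
    (c : HilbertBasis κ ℂ H) (x : H →L[ℂ] H) :
    ∑' i, ‖x (b i)‖ₑ ^ 2 = ∑' j, ‖x.adjoint (c j)‖ₑ ^ 2 := by
  calc ∑' i, ‖x (b i)‖ₑ ^ 2 = ∑' i, ∑' j, ‖⟪c j, x (b i)⟫_ℂ‖ₑ ^ 2 :=
        tsum_congr fun i => (tsum_enorm_inner_sq c _).symm
    _ = ∑' j, ∑' i, ‖⟪c j, x (b i)⟫_ℂ‖ₑ ^ 2 := ENNReal.tsum_comm
    _ = ∑' j, ∑' i, ‖⟪b i, x.adjoint (c j)⟫_ℂ‖ₑ ^ 2 := by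
        refine tsum_congr fun j => tsum_congr fun i => ?_
        rw [ContinuousLinearMap.adjoint_inner_right, ← enorm_norm, norm_inner_symm, enorm_norm]
    _ = ∑' j, ‖x.adjoint (c j)‖ₑ ^ 2 := tsum_congr fun j => tsum_enorm_inner_sq b _

/-- The sum that defines the Hilbert–Schmidt norm does not depend on the orthonormal basis. -/
theorem tsum_enorm_sq_eq {ι κ : Type*} (b : HilbertBasis ι ℂ H) (c : HilbertBasis κ ℂ H)
    (x : H →L[ℂ] H) : ∑' i, ‖x (b i)‖ₑ ^ 2 = ∑' j, ‖x (c j)‖ₑ ^ 2 :=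
  (tsum_enorm_sq_eq_adjoint b c x).trans (tsum_enorm_sq_eq_adjoint c c x).symm

/-! ### The weak* topology on `B(H)` -/

variable (H)

/-- The vector functional `x ↦ ⟪ξ, x η⟫` on `B(H)`. -/
def vectorFunctional (ξ η : H) : StrongDual ℂ (H →L[ℂ] H) :=
  (innerSL ℂ ξ).comp (ContinuousLinearMap.apply ℂ H η)

/-- The predual of `B(H)`, as the closed linear span of the vector functionals in the dual of
the Banach space `B(H)`; it consists of the functionals `x ↦ Tr (x a)` with `a` of trace class. -/
def predual : Submodule ℂ (StrongDual ℂ (H →L[ℂ] H)) :=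
  (Submodule.span ℂ
    (Set.range fun p : H × H => vectorFunctional H p.1 p.2)).topologicalClosure

/-- The duality between `B(H)` and its predual. -/
def pairing : (H →L[ℂ] H) →ₗ[ℂ] predual H →ₗ[ℂ] ℂ :=
  LinearMap.mk₂ ℂ (fun x ω => ω.1 x) (fun _ _ ω => map_add ω.1 _ _)
    (fun _ _ ω => map_smul ω.1 _ _) (fun _ _ _ => rfl) (fun _ _ _ => rfl)

/-- `B(H)` with its weak* topology, the topology of pointwise convergence on the predual. -/
abbrev WeakStarOp : Type _ := WeakBilin (pairing H)

/-- The identity map from `B(H)` to `B(H)` with its weak* topology. -/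
def toWeakStar : (H →L[ℂ] H) ≃ₗ[ℂ] WeakStarOp H := LinearEquiv.refl ℂ (H →L[ℂ] H)

variable {H}

/-- The weak* closure of a subspace of `B(H)`. -/
def weakStarClosure (S : Submodule ℂ (H →L[ℂ] H)) : Submodule ℂ (H →L[ℂ] H) :=
  (S.map (toWeakStar H).toLinearMap).topologicalClosure.comap (toWeakStar H).toLinearMap

/-! ### Quantum relations -/

/-- A quantum relation over `M ⊆ B(H)`: a weak* closed subspace of `B(H)` that is a bimodule over
the commutant of `M`. -/
structure IsQuantumRelation (M : VonNeumannAlgebra H) (S : Submodule ℂ (H →L[ℂ] H)) : Prop where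
  isClosed : IsClosed (toWeakStar H '' (S : Set (H →L[ℂ] H)))
  bimodule : ∀ a ∈ M.commutant, ∀ b ∈ M.commutant, ∀ x ∈ S, a * x * b ∈ S

/-- A Hilbert–Schmidt quantum relation over `M ⊆ B(H)`: a subspace of `HS(H)` that is closed for
the Hilbert–Schmidt norm and is a bimodule over the commutant of `M`. -/
structure IsHSQuantumRelation (M : VonNeumannAlgebra H) (V : Submodule ℂ (HilbertSchmidt H)) :
    Prop where
  isClosed : IsClosed (V : Set (HilbertSchmidt H))
  bimodule : ∀ a ∈ M.commutant, ∀ b ∈ M.commutant, ∀ x ∈ V, ∃ y ∈ V,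
    toOp H y = a * toOp H x * b

/-- `S_HS`: the closure, for the Hilbert–Schmidt norm, of `S ∩ HS(H)`. -/
def hsPart (S : Submodule ℂ (H →L[ℂ] H)) : Submodule ℂ (HilbertSchmidt H) :=
  (S.comap (toOp H)).topologicalClosure

/-- `V_{w*}`: the closure of `V ⊆ HS(H) ⊆ B(H)` in the weak* topology of `B(H)`. -/
def wStar (V : Submodule ℂ (HilbertSchmidt H)) : Submodule ℂ (H →L[ℂ] H) :=
  weakStarClosure (V.map (toOp H))

/-- The Hilbert–Schmidt hull `S^{hsh}`. -/
def hsHull (S : Submodule ℂ (H →L[ℂ] H)) : Submodule ℂ (H →L[ℂ] H) := wStar (hsPart S)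

/-- The Hilbert–Schmidt closure `V^{hsc}`. -/
def hsClosure (V : Submodule ℂ (HilbertSchmidt H)) : Submodule ℂ (HilbertSchmidt H) :=
  hsPart (wStar V)

end HSQuantum

end

/-!
The inclusion of `HS(H)`, with its own norm, into `B(H)` with the weak* topology is continuous,
because the Hilbert–Schmidt norm dominates the operator norm. Hence `S ∩ HS(H)` is already closed
for every weak* closed `S`, so that `V_{w*} ≤ S ↔ V ≤ S_HS`: the two constructions form a Galois
connection between closed subspaces, whose fixed points on either side are the values of the
adjoint landing there. They preserve bimodules because `HS(H)` is an ideal and `x ↦ a x b` is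
weak* continuous.
-/

namespace HSQuantum

theorem image_eq_setOf_eq_comp {α β : Type*} {f : α → β} {g : β → α} {s : Set α} {t : Set β}
    (hf : Set.MapsTo f s t) (hg : Set.MapsTo g t s) (hfgf : ∀ a ∈ s, f (g (f a)) = f a) :
    f '' s = {b | b ∈ t ∧ b = f (g b)} := by
  ext b
  constructor
  · rintro ⟨a, ha, rfl⟩
    exact ⟨hf ha, (hfgf a ha).symm⟩
  · rintro ⟨hb, hfix⟩
    exact ⟨g b, hg hb, hfix.symm⟩

theorem memℓp_two_iff_tsum_enorm_sq_ne_top {ι : Type*} {E : ι → Type*}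
    [∀ i, NormedAddCommGroup (E i)] {f : ∀ i, E i} :
    Memℓp f 2 ↔ ∑' i, ‖f i‖ₑ ^ 2 ≠ ∞ := by
  have h := tsum_enorm_ne_top_iff_summable_norm (f := fun i => ‖f i‖ ^ 2)
  simpa [memℓp_gen_iff, enorm_pow] using h.symm

variable {H : Type*} [NormedAddCommGroup H] [InnerProductSpace ℂ H]

theorem continuous_toWeakStar : Continuous (toWeakStar H) :=
  WeakBilin.continuous_of_continuous_eval _ fun ω => ω.1.continuous

theorem le_weakStarClosure (S : Submodule ℂ (H →L[ℂ] H)) : S ≤ weakStarClosure S :=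
  Submodule.map_le_iff_le_comap.1 (Submodule.le_topologicalClosure _)

theorem image_weakStarClosure (S : Submodule ℂ (H →L[ℂ] H)) :
    toWeakStar H '' (weakStarClosure S : Set (H →L[ℂ] H)) =
      closure (toWeakStar H '' (S : Set (H →L[ℂ] H))) :=
  Set.image_preimage_eq _ (toWeakStar H).surjective

theorem isClosed_weakStarClosure (S : Submodule ℂ (H →L[ℂ] H)) :
    IsClosed (toWeakStar H '' (weakStarClosure S : Set (H →L[ℂ] H))) :=
  (image_weakStarClosure S).symm ▸ isClosed_closure

theorem weakStarClosure_minimal {S T : Submodule ℂ (H →L[ℂ] H)} (h : S ≤ T)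
    (hT : IsClosed (toWeakStar H '' (T : Set (H →L[ℂ] H)))) : weakStarClosure S ≤ T :=
  (Set.image_subset_image_iff (toWeakStar H).injective).1 <|
    (image_weakStarClosure S).trans_subset (closure_minimal (Set.image_mono h) hT)

variable [CompleteSpace H]

theorem enorm_apply_sq_le_tsum {ι : Type*} (b : HilbertBasis ι ℂ H) (x : H →L[ℂ] H) (v : H) :
    ‖x v‖ₑ ^ 2 ≤ (∑' i, ‖x (b i)‖ₑ ^ 2) * ‖v‖ₑ ^ 2 := by
  have cauchy_schwarz (i : ι) : ‖⟪b i, x v⟫_ℂ‖ₑ ≤ ‖x.adjoint (b i)‖ₑ * ‖v‖ₑ := by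
    rw [← ContinuousLinearMap.adjoint_inner_left]
    simp only [enorm_eq_nnnorm]
    exact_mod_cast nnnorm_inner_le_nnnorm (𝕜 := ℂ) _ _
  calc ‖x v‖ₑ ^ 2 = ∑' i, ‖⟪b i, x v⟫_ℂ‖ₑ ^ 2 := (tsum_enorm_inner_sq b _).symm
    _ ≤ ∑' i, (‖x.adjoint (b i)‖ₑ * ‖v‖ₑ) ^ 2 := by gcongr with i; exact cauchy_schwarz i
    _ = (∑' i, ‖x (b i)‖ₑ ^ 2) * ‖v‖ₑ ^ 2 := by
      simp only [mul_pow, ENNReal.tsum_mul_right, tsum_enorm_sq_eq_adjoint b b x]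

theorem mem_hsSubmodule_iff {x : H →L[ℂ] H} :
    x ∈ hsSubmodule H ↔ ∑' i, ‖x (basis H i)‖ₑ ^ 2 ≠ ∞ :=
  memℓp_two_iff_tsum_enorm_sq_ne_top

theorem toOp_mem_hsSubmodule (x : HilbertSchmidt H) : toOp H x ∈ hsSubmodule H := x.2

theorem image_toOp_comap (S : Submodule ℂ (H →L[ℂ] H)) :
    toOp H '' (S.comap (toOp H)) = (S : Set (H →L[ℂ] H)) ∩ hsSubmodule H :=
  (Set.image_preimage_eq_inter_range (f := toOp H)).trans (congrArg _ Subtype.range_coe)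

theorem mul_left_mem_hsSubmodule (a : H →L[ℂ] H) {x : H →L[ℂ] H} (hx : x ∈ hsSubmodule H) :
    a * x ∈ hsSubmodule H :=
  Memℓp.mono' (hx.norm.const_mul ‖a‖) fun i => by simpa using a.le_opNorm (x (basis H i))

theorem adjoint_mem_hsSubmodule {x : H →L[ℂ] H} (hx : x ∈ hsSubmodule H) :
    x.adjoint ∈ hsSubmodule H := by
  rw [mem_hsSubmodule_iff] at hx ⊢
  rwa [← tsum_enorm_sq_eq_adjoint (basis H) (basis H)]

theorem mul_right_mem_hsSubmodule {x : H →L[ℂ] H} (hx : x ∈ hsSubmodule H) (b : H →L[ℂ] H) :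
    x * b ∈ hsSubmodule H := by
  have h := adjoint_mem_hsSubmodule
    (mul_left_mem_hsSubmodule b.adjoint (adjoint_mem_hsSubmodule hx))
  simpa only [← ContinuousLinearMap.star_eq_adjoint, star_mul, star_star] using h

theorem enorm_sq_eq_tsum (x : HilbertSchmidt H) :
    ‖x‖ₑ ^ 2 = ∑' i, ‖toOp H x (basis H i)‖ₑ ^ 2 := by
  have summable : Summable fun i => ‖toOp H x (basis H i)‖ ^ 2 := by
    simpa using (show Memℓp (fun i => toOp H x (basis H i)) 2 from x.2).summable (by norm_num)
  simp only [← ofReal_norm, ← ENNReal.ofReal_pow (norm_nonneg _), norm_sq_eq]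
  exact ENNReal.ofReal_tsum_of_nonneg (fun _ => by positivity) summable

theorem norm_toOp_le (x : HilbertSchmidt H) : ‖toOp H x‖ ≤ ‖x‖ := by
  refine ContinuousLinearMap.opNorm_le_bound _ (norm_nonneg _) fun v => ?_
  have h : ‖toOp H x v‖ₑ ^ 2 ≤ (‖x‖ₑ * ‖v‖ₑ) ^ 2 := by
    rw [mul_pow, enorm_sq_eq_tsum]
    exact enorm_apply_sq_le_tsum (basis H) (toOp H x) v
  rw [ENNReal.pow_le_pow_left_iff two_ne_zero] at h
  simp only [enorm_eq_nnnorm] at h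
  exact_mod_cast h

theorem continuous_toOp : Continuous (toOp H) :=
  AddMonoidHomClass.continuous_of_bound (toOp H) 1 fun x => by simpa using norm_toOp_le x

theorem vectorFunctional_comp_mulLeftRight (a b : H →L[ℂ] H) (ξ η : H) :
    (vectorFunctional H ξ η).comp (ContinuousLinearMap.mulLeftRight ℂ (H →L[ℂ] H) a b) =
      vectorFunctional H (a.adjoint ξ) (b η) := by
  ext x
  simp [vectorFunctional, ContinuousLinearMap.adjoint_inner_left]

theorem comp_mulLeftRight_mem_predual (a b : H →L[ℂ] H) {ω : StrongDual ℂ (H →L[ℂ] H)}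
    (hω : ω ∈ predual H) :
    ω.comp (ContinuousLinearMap.mulLeftRight ℂ (H →L[ℂ] H) a b) ∈ predual H := by
  let precomp : StrongDual ℂ (H →L[ℂ] H) →L[ℂ] StrongDual ℂ (H →L[ℂ] H) :=
    ContinuousLinearMap.precomp ℂ (ContinuousLinearMap.mulLeftRight ℂ (H →L[ℂ] H) a b)
  let vectorSpan := Submodule.span ℂ (Set.range fun p : H × H => vectorFunctional H p.1 p.2)
  have vectorSpan_le_comap : vectorSpan ≤ vectorSpan.comap precomp.toLinearMap := by
    refine Submodule.span_le.2 ?_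
    rintro _ ⟨⟨ξ, η⟩, rfl⟩
    exact Submodule.subset_span
      ⟨(a.adjoint ξ, b η), (vectorFunctional_comp_mulLeftRight a b ξ η).symm⟩
  exact map_mem_closure (f := precomp) precomp.continuous hω fun _ h => vectorSpan_le_comap h

theorem continuous_mul_mul_weakStar (a b : H →L[ℂ] H) :
    Continuous fun x : WeakStarOp H => toWeakStar H (a * (toWeakStar H).symm x * b) :=
  WeakBilin.continuous_of_continuous_eval _ fun ω =>
    WeakBilin.eval_continuous (pairing H) ⟨_, comp_mulLeftRight_mem_predual a b ω.2⟩

theorem mul_mul_mem_weakStarClosure {a b : H →L[ℂ] H} {S : Submodule ℂ (H →L[ℂ] H)}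
    (hS : ∀ x ∈ S, a * x * b ∈ S) {x : H →L[ℂ] H} (hx : x ∈ weakStarClosure S) :
    a * x * b ∈ weakStarClosure S := by
  refine map_mem_closure (x := toWeakStar H x) (continuous_mul_mul_weakStar a b) hx ?_
  rintro _ ⟨y, hy, rfl⟩
  exact ⟨_, hS y hy, rfl⟩

theorem isClosed_wStar (V : Submodule ℂ (HilbertSchmidt H)) :
    IsClosed (toWeakStar H '' (wStar V : Set (H →L[ℂ] H))) :=
  isClosed_weakStarClosure _

theorem hsPart_eq_comap {S : Submodule ℂ (H →L[ℂ] H)}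
    (hS : IsClosed (toWeakStar H '' (S : Set (H →L[ℂ] H)))) : hsPart S = S.comap (toOp H) := by
  refine IsClosed.submodule_topologicalClosure_eq ?_
  have h := hS.preimage (continuous_toWeakStar.comp (continuous_toOp (H := H)))
  rwa [Set.preimage_comp, Set.preimage_image_eq _ (toWeakStar H).injective] at h

theorem wStar_le_iff_le_hsPart {V : Submodule ℂ (HilbertSchmidt H)}
    {S : Submodule ℂ (H →L[ℂ] H)} (hS : IsClosed (toWeakStar H '' (S : Set (H →L[ℂ] H)))) :
    wStar V ≤ S ↔ V ≤ hsPart S := by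
  rw [hsPart_eq_comap hS, ← Submodule.map_le_iff_le_comap]
  exact ⟨(le_weakStarClosure _).trans, fun h => weakStarClosure_minimal h hS⟩

theorem le_hsClosure (V : Submodule ℂ (HilbertSchmidt H)) : V ≤ hsClosure V :=
  (wStar_le_iff_le_hsPart (isClosed_wStar V)).1 le_rfl

theorem hsHull_le {S : Submodule ℂ (H →L[ℂ] H)}
    (hS : IsClosed (toWeakStar H '' (S : Set (H →L[ℂ] H)))) : hsHull S ≤ S :=
  (wStar_le_iff_le_hsPart hS).2 le_rfl

theorem hsPart_mono {S T : Submodule ℂ (H →L[ℂ] H)} (h : S ≤ T) : hsPart S ≤ hsPart T :=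
  Submodule.topologicalClosure_mono (Submodule.comap_mono h)

theorem wStar_mono {V W : Submodule ℂ (HilbertSchmidt H)} (h : V ≤ W) : wStar V ≤ wStar W :=
  (wStar_le_iff_le_hsPart (isClosed_wStar W)).2 (h.trans (le_hsClosure W))

theorem hsClosure_hsPart {S : Submodule ℂ (H →L[ℂ] H)}
    (hS : IsClosed (toWeakStar H '' (S : Set (H →L[ℂ] H)))) :
    hsClosure (hsPart S) = hsPart S :=
  le_antisymm (hsPart_mono (hsHull_le hS)) (le_hsClosure _)

theorem hsHull_wStar (V : Submodule ℂ (HilbertSchmidt H)) : hsHull (wStar V) = wStar V :=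
  le_antisymm (hsHull_le (isClosed_wStar V)) (wStar_mono (le_hsClosure V))

/-- A weak* closed subspace of `B(H)` stable under `x ↦ a x b` for all `a ∈ A` and `b ∈ B`. For
`A = B = M'` it is a quantum relation over `M`. -/
structure IsWeakStarClosedBimodule (A B : Set (H →L[ℂ] H)) (S : Submodule ℂ (H →L[ℂ] H)) :
    Prop where
  isClosed : IsClosed (toWeakStar H '' (S : Set (H →L[ℂ] H)))
  mul_mul_mem : ∀ a ∈ A, ∀ b ∈ B, ∀ x ∈ S, a * x * b ∈ S

/-- A Hilbert–Schmidt closed subspace of `HS(H)` stable under `x ↦ a x b` for all `a ∈ A` and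
`b ∈ B`. For `A = B = M'` it is a Hilbert–Schmidt quantum relation over `M`. Stability is
expressed through `toOp`, since the product `a x b` is formed in `B(H)`. -/
structure IsHSClosedBimodule (A B : Set (H →L[ℂ] H)) (V : Submodule ℂ (HilbertSchmidt H)) :
    Prop where
  isClosed : IsClosed (V : Set (HilbertSchmidt H))
  exists_toOp_eq_mul_mul : ∀ a ∈ A, ∀ b ∈ B, ∀ x ∈ V, ∃ y ∈ V, toOp H y = a * toOp H x * b

variable {A B : Set (H →L[ℂ] H)}

theorem IsWeakStarClosedBimodule.hsPart {S : Submodule ℂ (H →L[ℂ] H)}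
    (hS : IsWeakStarClosedBimodule A B S) : IsHSClosedBimodule A B (hsPart S) where
  isClosed := Submodule.isClosed_topologicalClosure _
  exists_toOp_eq_mul_mul a ha b hb x hx := by
    rw [hsPart_eq_comap hS.isClosed] at hx ⊢
    have mem_hs : a * toOp H x * b ∈ hsSubmodule H :=
      mul_right_mem_hsSubmodule (mul_left_mem_hsSubmodule a (toOp_mem_hsSubmodule x)) b
    exact ⟨⟨_, mem_hs⟩, hS.mul_mul_mem a ha b hb _ hx, rfl⟩

theorem IsHSClosedBimodule.wStar {V : Submodule ℂ (HilbertSchmidt H)}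
    (hV : IsHSClosedBimodule A B V) : IsWeakStarClosedBimodule A B (wStar V) where
  isClosed := isClosed_wStar V
  mul_mul_mem a ha b hb x hx := by
    refine mul_mul_mem_weakStarClosure ?_ hx
    rintro _ ⟨y, hy, rfl⟩
    exact hV.exists_toOp_eq_mul_mul a ha b hb y hy

theorem image_hsPart_setOf_isWeakStarClosedBimodule (A B : Set (H →L[ℂ] H)) :
    hsPart '' {S | IsWeakStarClosedBimodule A B S} =
      {V | IsHSClosedBimodule A B V ∧ V = hsClosure V} :=
  image_eq_setOf_eq_comp (t := {V | IsHSClosedBimodule A B V}) (fun _ hS => hS.hsPart)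
    (fun _ hV => hV.wStar) fun _ hS => hsClosure_hsPart hS.isClosed

theorem image_wStar_setOf_isHSClosedBimodule (A B : Set (H →L[ℂ] H)) :
    wStar '' {V | IsHSClosedBimodule A B V} =
      {S | IsWeakStarClosedBimodule A B S ∧ S = hsHull S} :=
  image_eq_setOf_eq_comp (t := {S | IsWeakStarClosedBimodule A B S}) (fun _ hV => hV.wStar)
    (fun _ hS => hS.hsPart) fun V _ => hsHull_wStar V

theorem isQuantumRelation_iff {M : VonNeumannAlgebra H} {S : Submodule ℂ (H →L[ℂ] H)} :
    IsQuantumRelation M S ↔ IsWeakStarClosedBimodule M.commutant M.commutant S :=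
  ⟨fun h => ⟨h.isClosed, h.bimodule⟩, fun h => ⟨h.isClosed, h.mul_mul_mem⟩⟩

theorem isHSQuantumRelation_iff {M : VonNeumannAlgebra H}
    {V : Submodule ℂ (HilbertSchmidt H)} :
    IsHSQuantumRelation M V ↔ IsHSClosedBimodule M.commutant M.commutant V :=
  ⟨fun h => ⟨h.isClosed, h.bimodule⟩, fun h => ⟨h.isClosed, h.exists_toOp_eq_mul_mul⟩⟩

end HSQuantum

open HSQuantum in
theorem mainTheorem8_general {H : Type*} [NormedAddCommGroup H] [InnerProductSpace ℂ H]
    [CompleteSpace H] (A B : Set (H →L[ℂ] H)) :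
    (∀ S : Submodule ℂ (H →L[ℂ] H), IsWeakStarClosedBimodule A B S →
      toOp H '' (hsPart S) = (S : Set (H →L[ℂ] H)) ∩ hsSubmodule H) ∧
    {V | ∃ S, IsWeakStarClosedBimodule A B S ∧ hsPart S = V} =
      {V | IsHSClosedBimodule A B V ∧ V = hsClosure V} ∧
    {S | ∃ V, IsHSClosedBimodule A B V ∧ wStar V = S} =
      {S | IsWeakStarClosedBimodule A B S ∧ S = hsHull S} ∧
    Set.BijOn hsPart
      {S | IsWeakStarClosedBimodule A B S ∧ S = hsHull S}
      {V | IsHSClosedBimodule A B V ∧ V = hsClosure V} ∧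
    Set.BijOn wStar
      {V | IsHSClosedBimodule A B V ∧ V = hsClosure V}
      {S | IsWeakStarClosedBimodule A B S ∧ S = hsHull S} ∧
    Set.InvOn wStar hsPart
      {S | IsWeakStarClosedBimodule A B S ∧ S = hsHull S}
      {V | IsHSClosedBimodule A B V ∧ V = hsClosure V} := by
  have image_hsPart := image_hsPart_setOf_isWeakStarClosedBimodule A B
  have image_wStar := image_wStar_setOf_isHSClosedBimodule A B
  have mapsTo_hsPart : Set.MapsTo hsPart {S | IsWeakStarClosedBimodule A B S ∧ S = hsHull S}
      {V | IsHSClosedBimodule A B V ∧ V = hsClosure V} :=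
    fun S hS => image_hsPart.subset ⟨S, hS.1, rfl⟩
  have mapsTo_wStar : Set.MapsTo wStar {V | IsHSClosedBimodule A B V ∧ V = hsClosure V}
      {S | IsWeakStarClosedBimodule A B S ∧ S = hsHull S} :=
    fun V hV => image_wStar.subset ⟨V, hV.1, rfl⟩
  have inv : Set.InvOn wStar hsPart {S | IsWeakStarClosedBimodule A B S ∧ S = hsHull S}
      {V | IsHSClosedBimodule A B V ∧ V = hsClosure V} :=
    ⟨fun _ hS => hS.2.symm, fun _ hV => hV.2.symm⟩
  exact ⟨fun S hS => hsPart_eq_comap hS.isClosed ▸ image_toOp_comap S, image_hsPart, image_wStar,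
    inv.bijOn mapsTo_hsPart mapsTo_wStar, inv.symm.bijOn mapsTo_wStar mapsTo_hsPart, inv⟩

theorem mainTheorem8 {H : Type*} [NormedAddCommGroup H] [InnerProductSpace ℂ H] [CompleteSpace H]
    (M : VonNeumannAlgebra H) :
    (∀ S : Submodule ℂ (H →L[ℂ] H), HSQuantum.IsQuantumRelation M S →
      HSQuantum.toOp H '' (HSQuantum.hsPart S) = (S : Set (H →L[ℂ] H)) ∩ HSQuantum.hsSubmodule H) ∧
    {V | ∃ S, HSQuantum.IsQuantumRelation M S ∧ HSQuantum.hsPart S = V} =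
      {V | HSQuantum.IsHSQuantumRelation M V ∧ V = HSQuantum.hsClosure V} ∧
    {S | ∃ V, HSQuantum.IsHSQuantumRelation M V ∧ HSQuantum.wStar V = S} =
      {S | HSQuantum.IsQuantumRelation M S ∧ S = HSQuantum.hsHull S} ∧
    Set.BijOn HSQuantum.hsPart
      {S | HSQuantum.IsQuantumRelation M S ∧ S = HSQuantum.hsHull S}
      {V | HSQuantum.IsHSQuantumRelation M V ∧ V = HSQuantum.hsClosure V} ∧
    Set.BijOn HSQuantum.wStar
      {V | HSQuantum.IsHSQuantumRelation M V ∧ V = HSQuantum.hsClosure V}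
      {S | HSQuantum.IsQuantumRelation M S ∧ S = HSQuantum.hsHull S} ∧
    Set.InvOn HSQuantum.wStar HSQuantum.hsPart
      {S | HSQuantum.IsQuantumRelation M S ∧ S = HSQuantum.hsHull S}
      {V | HSQuantum.IsHSQuantumRelation M V ∧ V = HSQuantum.hsClosure V} := by
  simpa only [HSQuantum.isQuantumRelation_iff, HSQuantum.isHSQuantumRelation_iff] using
    mainTheorem8_general (M.commutant : Set (H →L[ℂ] H)) M.commutant
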